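/- **Definitions.** Let $G$ be a group and $\{H_\lambda\}_{\lambda\in\Lambda}$ a family of subgroups of $G$. - $(G,\{H_\lambda\})$ has *finite stature* if for each $\mu\in\Lambda$ there are only finitely many $H_\mu$-conjugacy classes of infinite subgroups of the form $H_\mu\cap C$, where $C$ is an intersection of (possibly infinitely many) $G$-conjugates of members of $\{H_\lambda\}$. - The *commensurable depth* of $\{H_\lambda\}$ in $G$ is the supremum in $\mathbb N\cup\{\infty\}$ of the lengths $d$ of strictly increasing chains $L_1<\cdots<L_d$ of subgroups of $G$, where each $L_i$ is an intersection of finitely many (at least one) $G$-conjugates of members of $\{H_\lambda\}$. It is *finite* if it is not $\infty$. - A *graph of groups* $\mathcal G$ consists of a graph (loops and multiple edges allowed), groups $G_v$ for its vertices $v$ and $G_e$ for its edges $e$, and, for each edge $e$, oriented from $s(e)$ to $t(e)$, injective homomorphisms $\sigma_e:G_e\to G_{s(e)}$ and $\tau_e:G_e\to G_{t(e)}$. Its *fundamental group* $\pi_1(\mathcal G,T)$ with respect to a spanning tree $T$ is the quotient of the free product of all $G_v$ and of the free group on letters $t_e$, one for each edge $e$, by the relations $t_e\,\tau_e(x)\,t_e^{-1}=\sigma_e(x)$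 for all edges $e$ and $x\in G_e$, and $t_e=1$ for all $e\in T$. A group $G$ *splits* as $\mathcal G$ if it is identified with $\pi_1(\mathcal G,T)$ by an isomorphism; its *vertex groups* are then the images of the $G_v$ in $G$. - A group is *virtually free* if it has a free subgroup of finite index. **Proposition.** Let $G$ split as a graph of groups whose underlying graph is finite and connected (and nonempty), such that each edge group has finite index in its vertex groups, i.e. $\sigma_e(G_e)$ has finite index in $G_{s(e)}$ and $\tau_e(G_e)$ has finite index in $G_{t(e)}$ for every edge $e$. Let $\mathcal V$ be the finite family of vertex groups of $G$. Then the following are equivalent: 1. $(G,\mathcal V)$ has finite stature. 2. $\mathcal V$ has finite commensurable depth in $G$. 3. There is a normal subgroup $N$ of $G$ that is contained in every vertex group of $G$ and has finite index in each of them, such that $G/N$ is a finitely generated virtually free group. -/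

import Mathlib

open scoped Pointwise

/-- A graph of groups over the graph with vertex set `V` and edge set `E`; loops and multiple
edges are allowed. Each edge is given one of its two orientations, from `src e` to `tgt e`. -/
structure GraphOfGroups (V : Type*) (E : Type*) where
  src : E → V
  tgt : E → V
  vertexGroup : V → Type*
  [instVertexGroup : ∀ v, Group (vertexGroup v)]
  edgeGroup : E → Type*
  [instEdgeGroup : ∀ e, Group (edgeGroup e)]
  toSrc : ∀ e, edgeGroup e →* vertexGroup (src e)
  toTgt : ∀ e, edgeGroup e →* vertexGroup (tgt e)
  toSrc_injective : ∀ e, Function.Injective (toSrc e)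
  toTgt_injective : ∀ e, Function.Injective (toTgt e)

namespace GraphOfGroups

attribute [instance] instVertexGroup instEdgeGroup

/-- The set `T` of edges is (the edge set of) a spanning tree of the underlying graph: it contains
no loop and no two parallel edges, and it is the edge set of a tree on all the vertices. -/
def IsSpanningTree {V E : Type*} (𝒢 : GraphOfGroups V E) (T : Set E) : Prop :=
  ∃ Γ : SimpleGraph V, Γ.IsTree ∧ Set.BijOn (fun e => s(𝒢.src e, 𝒢.tgt e)) T Γ.edgeSet

/-- The free product of all the vertex groups and of the free group on the edges. -/
abbrev FreeProduct {V E : Type*} (𝒢 : GraphOfGroups V E) : Type _ :=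
  Monoid.Coprod (Monoid.CoprodI 𝒢.vertexGroup) (FreeGroup E)

/-- The inclusion of a vertex group in the free product. -/
def freeVertex {V E : Type*} (𝒢 : GraphOfGroups V E) (v : V) :
    𝒢.vertexGroup v →* 𝒢.FreeProduct :=
  Monoid.Coprod.inl.comp Monoid.CoprodI.of

/-- The stable letter of an edge. -/
def stableLetter {V E : Type*} (𝒢 : GraphOfGroups V E) (e : E) : 𝒢.FreeProduct :=
  Monoid.Coprod.inr (FreeGroup.of e)

/-- The relators of the fundamental group with respect to the spanning tree `T`:
`t_e · tgt_e(x) · t_e⁻¹ = src_e(x)` for every edge `e` and every `x` in its group, and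
`t_e = 1` for every edge `e` of `T`. -/
def relators {V E : Type*} (𝒢 : GraphOfGroups V E) (T : Set E) : Set 𝒢.FreeProduct :=
  {r | ∃ (e : E) (x : 𝒢.edgeGroup e),
      r = 𝒢.stableLetter e * 𝒢.freeVertex (𝒢.tgt e) (𝒢.toTgt e x) * (𝒢.stableLetter e)⁻¹ *
        (𝒢.freeVertex (𝒢.src e) (𝒢.toSrc e x))⁻¹} ∪
    {r | ∃ e ∈ T, r = 𝒢.stableLetter e}

/-- The fundamental group of the graph of groups with respect to the spanning tree `T`. -/
abbrev FundamentalGroup {V E : Type*} (𝒢 : GraphOfGroups V E) (T : Set E) : Type _ :=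
  𝒢.FreeProduct ⧸ Subgroup.normalClosure (𝒢.relators T)

/-- The canonical map from a vertex group to the fundamental group. -/
def vertexHom {V E : Type*} (𝒢 : GraphOfGroups V E) (T : Set E) (v : V) :
    𝒢.vertexGroup v →* 𝒢.FundamentalGroup T :=
  (QuotientGroup.mk' _).comp (𝒢.freeVertex v)

/-- The vertex groups as subgroups of a group `G` that is identified with the fundamental group
of the graph of groups. -/
def vertexSubgroup {V E : Type*} (𝒢 : GraphOfGroups V E) (T : Set E) {G : Type*} [Group G]
    (φ : 𝒢.FundamentalGroup T ≃* G) (v : V) : Subgroup G :=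
  (φ.toMonoidHom.comp (𝒢.vertexHom T v)).range

end GraphOfGroups

section Stature

/-- The intersection of the conjugates `g H_l g⁻¹`, where `(l, g)` runs over `S`. -/
def conjInter {G : Type*} [Group G] {Λ : Type*} (H : Λ → Subgroup G) (S : Set (Λ × G)) :
    Subgroup G :=
  ⨅ p ∈ S, MulAut.conj p.2 • H p.1

/-- The conjugacy class of the subgroup `L` under conjugation by the elements of `K`. -/
def subgroupConjClass {G : Type*} [Group G] (K L : Subgroup G) : Set (Subgroup G) :=
  {M | ∃ k ∈ K, M = MulAut.conj k • L}

/-- Finite stature: for each `μ`, there are only finitely many `H_μ`-conjugacy classes of infinite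
subgroups `H_μ ∩ C` with `C` an intersection of (possibly infinitely many) `G`-conjugates of
members of the family. -/
def HasFiniteStature {G : Type*} [Group G] {Λ : Type*} (H : Λ → Subgroup G) : Prop :=
  ∀ μ : Λ, {c : Set (Subgroup G) | ∃ S : Set (Λ × G), S.Nonempty ∧
    Infinite (H μ ⊓ conjInter H S : Subgroup G) ∧
      c = subgroupConjClass (H μ) (H μ ⊓ conjInter H S)}.Finite

/-- The commensurable depth: the supremum of the lengths `d` of the strictly increasing chains
`L_1 < ⋯ < L_d` of intersections of finitely many conjugates of members of the family. -/
noncomputable def commensurableDepth {G : Type*} [Group G] {Λ : Type*} (H : Λ → Subgroup G) :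
    ℕ∞ :=
  sSup {n : ℕ∞ | ∃ (d : ℕ) (L : Fin d → Subgroup G), n = d ∧ StrictMono L ∧
    ∀ i, ∃ S : Set (Λ × G), S.Finite ∧ S.Nonempty ∧ L i = conjInter H S}

/-- Finite commensurable depth. -/
def HasFiniteCommensurableDepth {G : Type*} [Group G] {Λ : Type*} (H : Λ → Subgroup G) : Prop :=
  commensurableDepth H < ⊤

/-- A group is virtually free if it has a free subgroup of finite index. -/
def IsVirtuallyFree (G : Type*) [Group G] : Prop :=
  ∃ F : Subgroup G, F.FiniteIndex ∧ IsFreeGroup F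

end Stature

/-! Finite edge indices make all conjugates of vertex groups commensurable
(`relIndex_conj_vertexSubgroup_ne_zero`), so a finite intersection of conjugates has finite index in
every vertex group. If such an intersection lies in all conjugates, it is the intersection of all of
them, hence normal: this is the `N` of condition 3 (`exists_normal_of_minimal`). Finite depth yields
one because finite intersections cannot descend forever; finite stature yields one because their
indices in an infinite vertex group take finitely many values, so some index is maximal. Conversely,
given `N`, all intersections lie above `N`, and only finitely many subgroups lie between `N` and a
given vertex group.

It remains to see that `G ⧸ N` is finitely generated and virtually free. Vertex groups have finite
image, which gives generation. For freeness, `exists_hom_perm` glues actions of the vertex groups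
into an action of `G` on a finite set `X` in which every point has stabilizer `N` in each vertex
group. In place of Bass–Serre theory, `isVirtuallyFree_of_mulAction` lifts `G` to a wreath product
`(X → A) ⋊ G` with `A` free. At a point of `X`, the `A`-coordinate restricts to a homomorphism on
the stabilizer `S` with kernel `S ∩ N`, so the image of `S` in `G ⧸ N` embeds in `A` and is free by
Nielsen–Schreier. -/

namespace GraphOfGroups

/-! ### Universal property and generators of the fundamental group. -/

variable {V E : Type*} (𝒢 : GraphOfGroups V E) (T : Set E)

/-- The image of the stable letter of an edge in the fundamental group. -/
def edgeElement (e : E) : 𝒢.FundamentalGroup T :=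
  QuotientGroup.mk' _ (𝒢.stableLetter e)

theorem edgeElement_conj (e : E) (x : 𝒢.edgeGroup e) :
    𝒢.edgeElement T e * 𝒢.vertexHom T (𝒢.tgt e) (𝒢.toTgt e x) * (𝒢.edgeElement T e)⁻¹ =
      𝒢.vertexHom T (𝒢.src e) (𝒢.toSrc e x) := by
  have h : 𝒢.stableLetter e * 𝒢.freeVertex (𝒢.tgt e) (𝒢.toTgt e x) * (𝒢.stableLetter e)⁻¹ *
        (𝒢.freeVertex (𝒢.src e) (𝒢.toSrc e x))⁻¹ ∈ Subgroup.normalClosure (𝒢.relators T) :=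
    Subgroup.subset_normalClosure (Or.inl ⟨e, x, rfl⟩)
  rw [← QuotientGroup.eq_one_iff] at h
  exact mul_inv_eq_one.mp h

variable {T} in
theorem edgeElement_eq_one {e : E} (he : e ∈ T) : 𝒢.edgeElement T e = 1 :=
  (QuotientGroup.eq_one_iff _).mpr (Subgroup.subset_normalClosure (Or.inr ⟨e, he, rfl⟩))

theorem exists_lift {B : Type*} [Group B] (f : ∀ v, 𝒢.vertexGroup v →* B) (b : E → B)
    (h : ∀ e x, b e * f (𝒢.tgt e) (𝒢.toTgt e x) * (b e)⁻¹ = f (𝒢.src e) (𝒢.toSrc e x))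
    (hT : ∀ e ∈ T, b e = 1) :
    ∃ F : 𝒢.FundamentalGroup T →* B, (∀ v x, F (𝒢.vertexHom T v x) = f v x) ∧
      ∀ e, F (𝒢.edgeElement T e) = b e := by
  let F₀ : 𝒢.FreeProduct →* B := Monoid.Coprod.lift (Monoid.CoprodI.lift f) (FreeGroup.lift b)
  have hv : ∀ v x, F₀ (𝒢.freeVertex v x) = f v x := fun v x => by simp [F₀, freeVertex]
  have he : ∀ e, F₀ (𝒢.stableLetter e) = b e := fun e => by simp [F₀, stableLetter]
  have hk : Subgroup.normalClosure (𝒢.relators T) ≤ F₀.ker := by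
    apply Subgroup.normalClosure_le_normal
    rintro r (⟨e, x, rfl⟩ | ⟨e, heT, rfl⟩)
    · simp [MonoidHom.mem_ker, hv, he, h]
    · simp [MonoidHom.mem_ker, he, hT e heT]
  exact ⟨QuotientGroup.lift _ F₀ hk, hv, he⟩

theorem closure_eq_top :
    Subgroup.closure ((⋃ v, Set.range (𝒢.vertexHom T v)) ∪ Set.range (𝒢.edgeElement T)) = ⊤ := by
  set K := Subgroup.closure ((⋃ v, Set.range (𝒢.vertexHom T v)) ∪ Set.range (𝒢.edgeElement T))
  have hv : ∀ v x, 𝒢.vertexHom T v x ∈ K := fun v x =>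
    Subgroup.subset_closure (Or.inl (Set.mem_iUnion.mpr ⟨v, x, rfl⟩))
  have he : ∀ e, 𝒢.edgeElement T e ∈ K := fun e => Subgroup.subset_closure (Or.inr ⟨e, rfl⟩)
  suffices h : K.comap (QuotientGroup.mk' (Subgroup.normalClosure (𝒢.relators T))) = ⊤ by
    rw [eq_top_iff]
    intro g _
    obtain ⟨y, rfl⟩ := QuotientGroup.mk'_surjective _ g
    exact (h ▸ Subgroup.mem_top y :
      y ∈ K.comap (QuotientGroup.mk' (Subgroup.normalClosure (𝒢.relators T))))
  rw [eq_top_iff, ← Monoid.Coprod.range_inl_sup_range_inr, sup_le_iff]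
  constructor
  · rintro _ ⟨y, rfl⟩
    induction y using Monoid.CoprodI.induction_on with
    | one => simp
    | of v x => exact hv v x
    | mul x y hx hy => rw [map_mul]; exact mul_mem hx hy
  · rintro _ ⟨y, rfl⟩
    induction y using FreeGroup.induction_on with
    | C1 => simp
    | of e => exact he e
    | inv_of e h => rw [map_inv]; exact inv_mem h
    | mul x y hx hy => rw [map_mul]; exact mul_mem hx hy

variable {T}
variable {G : Type*} [Group G] (φ : 𝒢.FundamentalGroup T ≃* G)

/-- The canonical map from a vertex group to a group identified with the fundamental group. -/
def vertexMap (v : V) : 𝒢.vertexGroup v →* G := φ.toMonoidHom.comp (𝒢.vertexHom T v)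

/-- The stable letter of an edge in a group identified with the fundamental group. -/
def letter (e : E) : G := φ (𝒢.edgeElement T e)

theorem range_vertexMap (v : V) : (𝒢.vertexMap φ v).range = 𝒢.vertexSubgroup T φ v := rfl

theorem letter_conj (e : E) (x : 𝒢.edgeGroup e) :
    𝒢.letter φ e * 𝒢.vertexMap φ (𝒢.tgt e) (𝒢.toTgt e x) * (𝒢.letter φ e)⁻¹ =
      𝒢.vertexMap φ (𝒢.src e) (𝒢.toSrc e x) := by
  simpa [letter, vertexMap] using congrArg φ (𝒢.edgeElement_conj T e x)

theorem letter_eq_one {e : E} (he : e ∈ T) : 𝒢.letter φ e = 1 := by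
  simp [letter, 𝒢.edgeElement_eq_one he]

theorem exists_hom {B : Type*} [Group B] (f : ∀ v, 𝒢.vertexGroup v →* B) (b : E → B)
    (h : ∀ e x, b e * f (𝒢.tgt e) (𝒢.toTgt e x) * (b e)⁻¹ = f (𝒢.src e) (𝒢.toSrc e x))
    (hT : ∀ e ∈ T, b e = 1) :
    ∃ F : G →* B, (∀ v x, F (𝒢.vertexMap φ v x) = f v x) ∧ ∀ e, F (𝒢.letter φ e) = b e := by
  obtain ⟨F, hF, hF'⟩ := 𝒢.exists_lift T f b h hT
  exact ⟨F.comp φ.symm.toMonoidHom, fun v x => by simp [vertexMap, hF],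
    fun e => by simp [letter, hF']⟩

theorem eq_top_of_generators {K : Subgroup G} (hv : ∀ v x, 𝒢.vertexMap φ v x ∈ K)
    (he : ∀ e, 𝒢.letter φ e ∈ K) : K = ⊤ := by
  have h : K.comap φ.toMonoidHom = ⊤ := by
    rw [eq_top_iff, ← 𝒢.closure_eq_top T, Subgroup.closure_le]
    rintro _ (hx | ⟨e, rfl⟩)
    · obtain ⟨v, x, rfl⟩ := Set.mem_iUnion.mp hx
      exact hv v x
    · exact he e
  rw [eq_top_iff]
  intro g _
  have : φ.symm g ∈ K.comap φ.toMonoidHom := h ▸ Subgroup.mem_top _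
  simpa using this

theorem hom_ext {B : Type*} [Group B] {F F' : G →* B}
    (hv : ∀ v x, F (𝒢.vertexMap φ v x) = F' (𝒢.vertexMap φ v x))
    (he : ∀ e, F (𝒢.letter φ e) = F' (𝒢.letter φ e)) : F = F' := by
  have h : F.eqLocus F' = ⊤ := 𝒢.eq_top_of_generators φ hv he
  ext g
  exact (h ▸ Subgroup.mem_top g : g ∈ F.eqLocus F')

end GraphOfGroups

/-! ### Coboundaries and propagation along a spanning tree. -/

/-- Along the edges of a tree, a group-valued edge function is the coboundary of a vertex
function. -/
theorem SimpleGraph.IsTree.exists_coboundary {V : Type*} {Γ : SimpleGraph V} (hΓ : Γ.IsTree)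
    {A : Type*} [Group A] (d : V → V → A) (hd : ∀ u v, Γ.Adj u v → d v u = (d u v)⁻¹) :
    ∃ s : V → A, ∀ u v, Γ.Adj u v → s v = s u * d u v := by
  obtain ⟨r⟩ := hΓ.connected.nonempty
  -- The vertex function is the product of the labels along the path from the root `r`.
  let weight : ∀ {u v : V}, Γ.Walk u v → A := fun p => (p.darts.map fun a => d a.fst a.snd).prod
  choose p hp hp' using fun v => hΓ.existsUnique_path r v
  refine ⟨fun v => weight (p v), fun u v huv => ?_⟩
  have key : ∀ u v (huv : Γ.Adj u v), u ∈ (p v).support →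
      weight (p v) = weight (p u) * d u v := fun u v huv hu => by
    rw [hΓ.isAcyclic.path_concat (hp u) (hp v) huv hu]
    simp [weight, SimpleGraph.Walk.darts_concat]
  -- For adjacent vertices, one of the two paths from the root extends the other by this edge.
  by_cases hu : u ∈ (p v).support
  · exact key u v huv hu
  · have hv := hΓ.isAcyclic.mem_support_of_ne_mem_support_of_adj_of_isPath (hp u) (hp v)
      huv hu
    change weight (p v) = weight (p u) * d u v
    rw [key v u huv.symm hv, hd u v huv, inv_mul_cancel_right]

namespace GraphOfGroups

variable {V E : Type*} (𝒢 : GraphOfGroups V E) {T : Set E}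

variable {𝒢} in
-- Used to normalize homomorphisms: twisting the vertex maps by `s` makes the stable letters of the
-- tree edges trivial, as the relators require.
theorem IsSpanningTree.exists_coboundary (hT : 𝒢.IsSpanningTree T) {A : Type*} [Group A]
    (d : E → A) : ∃ s : V → A, ∀ e ∈ T, s (𝒢.tgt e) = s (𝒢.src e) * d e := by
  classical
  obtain ⟨Γ, hΓ, hbij⟩ := hT
  have hne : ∀ e ∈ T, Γ.Adj (𝒢.src e) (𝒢.tgt e) := fun e he => hbij.mapsTo he
  let D : V → V → A := fun u v =>
    if h : ∃ e ∈ T, 𝒢.src e = u ∧ 𝒢.tgt e = v then d h.choose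
    else if h : ∃ e ∈ T, 𝒢.src e = v ∧ 𝒢.tgt e = u then (d h.choose)⁻¹ else 1
  have hD : ∀ e ∈ T, D (𝒢.src e) (𝒢.tgt e) = d e := fun e he => by
    have h : ∃ e' ∈ T, 𝒢.src e' = 𝒢.src e ∧ 𝒢.tgt e' = 𝒢.tgt e := ⟨e, he, rfl, rfl⟩
    have : h.choose = e := hbij.injOn h.choose_spec.1 he (by
      simp [h.choose_spec.2.1, h.choose_spec.2.2])
    simp only [D, dif_pos h, this]
  have hD' : ∀ e ∈ T, D (𝒢.tgt e) (𝒢.src e) = (d e)⁻¹ := fun e he => by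
    have h₀ : ¬ ∃ e' ∈ T, 𝒢.src e' = 𝒢.tgt e ∧ 𝒢.tgt e' = 𝒢.src e := by
      rintro ⟨e', he', h1, h2⟩
      have : e' = e := hbij.injOn he' he (by simp [h1, h2])
      subst this
      exact (hne e' he').ne h1
    have h : ∃ e' ∈ T, 𝒢.src e' = 𝒢.src e ∧ 𝒢.tgt e' = 𝒢.tgt e := ⟨e, he, rfl, rfl⟩
    have : h.choose = e := hbij.injOn h.choose_spec.1 he (by
      simp [h.choose_spec.2.1, h.choose_spec.2.2])
    simp only [D, dif_neg h₀, dif_pos h, this]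
  obtain ⟨s, hs⟩ := hΓ.exists_coboundary D fun u v huv => by
    obtain ⟨e, he, h⟩ := hbij.surjOn (show s(u, v) ∈ Γ.edgeSet from huv)
    rcases Sym2.eq_iff.mp h with ⟨rfl, rfl⟩ | ⟨rfl, rfl⟩
    · rw [hD e he, hD' e he]
    · rw [hD e he, hD' e he, inv_inv]
  exact ⟨s, fun e he => by rw [hs _ _ (hne e he), hD e he]⟩

variable {𝒢} in
/-- A property of vertices that is invariant along the edges of a spanning tree and holds
somewhere holds everywhere. -/
theorem IsSpanningTree.eq_of_edges (hT : 𝒢.IsSpanningTree T) {α : Type*} (r : α → α → Prop)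
    (hr : Equivalence r) (k : V → α) (hk : ∀ e ∈ T, r (k (𝒢.src e)) (k (𝒢.tgt e))) (u v : V) :
    r (k u) (k v) := by
  obtain ⟨Γ, hΓ, hbij⟩ := hT
  obtain ⟨p⟩ := hΓ.connected.preconnected u v
  induction p with
  | nil => exact hr.refl _
  | @cons u v _ h _ ih =>
    refine hr.trans ?_ ih
    obtain ⟨e, he, h⟩ := hbij.surjOn (show s(u, v) ∈ Γ.edgeSet from h)
    rcases Sym2.eq_iff.mp h with ⟨rfl, rfl⟩ | ⟨rfl, rfl⟩
    · exact hk e he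
    · exact hr.symm (hk e he)

variable {𝒢} in
theorem IsSpanningTree.nonempty (hT : 𝒢.IsSpanningTree T) : Nonempty V := by
  obtain ⟨Γ, hΓ, -⟩ := hT
  exact hΓ.connected.nonempty

end GraphOfGroups

/-! ### Actions with constant stabilizers, and wreath products. -/

theorem MulAction.card_eq_card_orbits_mul_index {K X : Type*} [Group K] [MulAction K X]
    {S : Subgroup K} (hS : ∀ x : X, stabilizer K x = S) :
    Nat.card X = Nat.card (orbitRel.Quotient K X) * S.index := by
  have e : (Σ ω : orbitRel.Quotient K X, K ⧸ stabilizer K ω.out) ≃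
      (Σ _ : orbitRel.Quotient K X, K ⧸ S) :=
    Equiv.sigmaCongrRight fun ω => Subgroup.quotientEquivOfEq (hS _)
  rw [Nat.card_congr (selfEquivSigmaOrbitsQuotientStabilizer K X), Nat.card_congr e,
    Nat.card_congr (Equiv.sigmaEquivProd _ _), Nat.card_prod]
  rfl

/-- Two actions on finite sets of the same size with all stabilizers equal to one and the same
subgroup are isomorphic. -/
theorem MulAction.exists_equivariant_equiv {K X Y : Type*} [Group K] [MulAction K X]
    [MulAction K Y] [Finite X] [Finite Y] (hcard : Nat.card X = Nat.card Y) {S : Subgroup K}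
    (hX : ∀ x : X, stabilizer K x = S) (hY : ∀ y : Y, stabilizer K y = S) :
    ∃ t : X ≃ Y, ∀ (k : K) (x : X), t (k • x) = k • t x := by
  classical
  rcases isEmpty_or_nonempty X with hXe | hXn
  · have : IsEmpty Y := by
      rw [← Finite.card_eq_zero_iff, ← hcard, Finite.card_eq_zero_iff]; exact hXe
    exact ⟨Equiv.equivOfIsEmpty X Y, fun k x => isEmptyElim x⟩
  have horb : Nat.card (orbitRel.Quotient K X) = Nat.card (orbitRel.Quotient K Y) := by
    have h1 := card_eq_card_orbits_mul_index hX
    have h2 := card_eq_card_orbits_mul_index hY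
    have hpos : S.index ≠ 0 := by
      intro h
      rw [h, mul_zero] at h1
      exact Nat.card_pos.ne' h1
    exact Nat.eq_of_mul_eq_mul_right (Nat.pos_of_ne_zero hpos) (by rw [← h1, ← h2, hcard])
  let ε : orbitRel.Quotient K X ≃ orbitRel.Quotient K Y := Classical.choice ((Finite.card_eq).mp horb)
  have hγ : ∀ x : X, ∃ k : K, k • (Quotient.mk (orbitRel K X) x).out = x := fun x =>
    (orbitRel_apply.mp (Quotient.exact (Quotient.out_eq (Quotient.mk (orbitRel K X) x)).symm))
  choose γ hγ using hγ
  have hstab : ∀ (k k' : K) (x : X), k • x = k' • x ↔ k⁻¹ * k' ∈ S := fun k k' x => by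
    rw [← hX x, mem_stabilizer_iff, mul_smul, inv_smul_eq_iff, eq_comm]
  have hstab' : ∀ (k k' : K) (y : Y), k • y = k' • y ↔ k⁻¹ * k' ∈ S := fun k k' y => by
    rw [← hY y, mem_stabilizer_iff, mul_smul, inv_smul_eq_iff, eq_comm]
  -- `γ x` carries the representative of the orbit of `x` to `x`. Its ambiguity is a coset of `S`,
  -- which also fixes the representative in `Y`.
  let f : X → Y := fun x => γ x • (ε (Quotient.mk (orbitRel K X) x)).out
  have hf : ∀ k x, f (k • x) = k • f x := fun k x => by
    have hq : Quotient.mk (orbitRel K X) (k • x) = Quotient.mk (orbitRel K X) x :=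
      Quotient.sound (orbitRel_apply.mpr ⟨k, rfl⟩)
    have h1 := hγ (k • x)
    rw [hq] at h1
    simp only [f, hq, ← mul_smul]
    rw [hstab', ← hstab _ _ (Quotient.mk (orbitRel K X) x).out, h1, mul_smul, hγ]
  have hinj : Function.Injective f := fun x x' h => by
    have h1 : ε (Quotient.mk (orbitRel K X) x) = ε (Quotient.mk (orbitRel K X) x') := by
      rw [← Quotient.out_eq (ε (Quotient.mk (orbitRel K X) x)),
        ← Quotient.out_eq (ε (Quotient.mk (orbitRel K X) x'))]
      apply Quotient.sound
      refine orbitRel_apply.mpr ⟨(γ x)⁻¹ * γ x', ?_⟩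
      simp only [mul_smul]
      rw [inv_smul_eq_iff]
      exact h.symm
    have h2 := ε.injective h1
    simp only [f, h2] at h
    rw [hstab', ← hstab _ _ (Quotient.mk (orbitRel K X) x').out, hγ x', ← h2, hγ x] at h
    exact h
  exact ⟨Equiv.ofBijective f ((Nat.bijective_iff_injective_and_card f).mpr ⟨hinj, hcard⟩), hf⟩

/-- The range of a homomorphism with the same kernel as a homomorphism to a free group is
free. -/
theorem MonoidHom.isFreeGroup_range_of_ker_eq {S Q A : Type*} [Group S] [Group Q] [Group A] [IsFreeGroup A]
    (p : S →* Q) (h : S →* A) (hker : h.ker = p.ker) : IsFreeGroup p.range := by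
  have e : h.range ≃* p.range :=
    (QuotientGroup.quotientKerEquivRange h).symm.trans
      ((QuotientGroup.quotientMulEquivOfEq hker).trans (QuotientGroup.quotientKerEquivRange p))
  -- Nielsen–Schreier: `h.range` is free as a subgroup of `A`.
  exact IsFreeGroup.ofMulEquiv e

/-- If the stabilizers in `H` of the points of a `G`-set lie in a normal subgroup `N` of `G`, then
there is an `H`-equivariant map to `G ⧸ N`. -/
theorem MulAction.exists_equivariant_map {G X : Type*} [Group G] [MulAction G X] (H : Subgroup G)
    (N : Subgroup G) [N.Normal] (hfree : ∀ h ∈ H, ∀ x : X, h • x = x → h ∈ N) :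
    ∃ γ : X → G ⧸ N, ∀ h ∈ H, ∀ x, γ (h • x) = (h : G ⧸ N) * γ x := by
  have hk : ∀ x : X, ∃ k : H, k • (Quotient.mk (orbitRel H X) x).out = x := fun x =>
    orbitRel_apply.mp (Quotient.exact (Quotient.out_eq (Quotient.mk (orbitRel H X) x)).symm)
  choose k hk using hk
  refine ⟨fun x => ((k x : G) : G ⧸ N), fun h hh x => ?_⟩
  have hq : Quotient.mk (orbitRel H X) (h • x) = Quotient.mk (orbitRel H X) x :=
    Quotient.sound (orbitRel_apply.mpr ⟨⟨h, hh⟩, rfl⟩)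
  have h1 := hk (h • x)
  rw [hq] at h1
  have h2 : ((h * k x)⁻¹ * (k (h • x) : G)) ∈ N := by
    refine hfree _ (mul_mem (inv_mem (mul_mem hh (k x).2)) (k (h • x)).2)
      (Quotient.mk (orbitRel H X) x).out ?_
    have h3 : (k (h • x) : G) • (Quotient.mk (orbitRel H X) x).out = h • x := h1
    have h4 : (k x : G) • (Quotient.mk (orbitRel H X) x).out = x := hk x
    rw [mul_smul, h3, inv_smul_eq_iff, mul_smul, h4]
  exact (QuotientGroup.eq.mpr h2).symm

/-- A group with a normal subgroup of finite index acts on a finite set of any size divisible by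
the index, with all stabilizers equal to that subgroup. -/
theorem Subgroup.exists_hom_perm_fin {K : Type*} [Group K] (S : Subgroup K) [S.Normal]
    [S.FiniteIndex] {n : ℕ} (hn : S.index ∣ n) :
    ∃ ρ : K →* Equiv.Perm (Fin n), ∀ k x, ρ k x = x ↔ k ∈ S := by
  obtain ⟨m, rfl⟩ := hn
  have : Finite (K ⧸ S) := Subgroup.finite_quotient_of_finiteIndex
  have hcard : Nat.card (Fin m × K ⧸ S) = Nat.card (Fin (S.index * m)) := by
    rw [Nat.card_prod, Nat.card_fin, Nat.card_fin, mul_comm]; rfl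
  obtain ⟨e⟩ := Finite.card_eq.mp hcard
  let ρ₀ : K →* Equiv.Perm (Fin m × K ⧸ S) :=
    { toFun := fun k => (Equiv.refl _).prodCongr (MulAction.toPerm k)
      map_one' := by ext x <;> simp
      map_mul' := fun a b => by ext x <;> simp [mul_smul] }
  refine ⟨e.permCongrHom.toMonoidHom.comp ρ₀, fun k x => ?_⟩
  have h : (e.permCongrHom.toMonoidHom.comp ρ₀) k x = e (ρ₀ k (e.symm x)) := rfl
  rw [h, ← Equiv.eq_symm_apply]
  obtain ⟨i, q⟩ := e.symm x
  obtain ⟨a, rfl⟩ := QuotientGroup.mk_surjective q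
  have h2 : ρ₀ k (i, (a : K ⧸ S)) = (i, ((k * a : K) : K ⧸ S)) := rfl
  rw [h2, Prod.mk.injEq, eq_self, true_and, eq_comm, QuotientGroup.eq, ← mul_assoc,
    Subgroup.Normal.mem_comm_iff ‹_›, mul_inv_cancel_left]

theorem MonoidHom.exists_perm_conj {K X : Type*} [Group K] [Finite X] {S : Subgroup K}
    (ρ ρ' : K →* Equiv.Perm X) (h : ∀ k x, ρ k x = x ↔ k ∈ S) (h' : ∀ k x, ρ' k x = x ↔ k ∈ S) :
    ∃ t : Equiv.Perm X, ∀ k, t * ρ k * t⁻¹ = ρ' k := by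
  obtain ⟨t, ht⟩ := @MulAction.exists_equivariant_equiv K X X _ (MulAction.compHom X ρ)
    (MulAction.compHom X ρ') _ _ rfl S (fun x => Subgroup.ext fun k => h k x)
    (fun x => Subgroup.ext fun k => h' k x)
  refine ⟨t, fun k => mul_inv_eq_iff_eq_mul.mpr (Equiv.ext fun x => ht k x)⟩

theorem SemidirectProduct.mul_left_mulAutArrow_apply {G X A : Type*} [Group G] [MulAction G X]
    [Group A] (a b : (X → A) ⋊[mulAutArrow] G) (x : X) :
    (a * b).left x = a.left x * b.left (a.right⁻¹ • x) := rfl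

theorem SemidirectProduct.inv_left_mulAutArrow_apply {G X A : Type*} [Group G] [MulAction G X]
    [Group A] (a : (X → A) ⋊[mulAutArrow] G) (x : X) :
    a⁻¹.left x = (a.left (a.right • x))⁻¹ := by
  rw [← inv_inv a.right]
  rfl

/-! ### The quotient by `N` is virtually free and finitely generated. -/

namespace GraphOfGroups

variable {V E : Type*} (𝒢 : GraphOfGroups V E) {T : Set E} {G : Type*} [Group G]
  (φ : 𝒢.FundamentalGroup T ≃* G)

theorem vertexMap_mem_vertexSubgroup (v : V) (g : 𝒢.vertexGroup v) :
    𝒢.vertexMap φ v g ∈ 𝒢.vertexSubgroup T φ v := ⟨g, rfl⟩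

/-- If the fundamental group acts on a finite set with all vertex stabilizers equal to `N`, then
its quotient by `N` is virtually free. -/
theorem isVirtuallyFree_of_mulAction (hT : 𝒢.IsSpanningTree T) (N : Subgroup G) [N.Normal]
    (hN : ∀ v, N ≤ 𝒢.vertexSubgroup T φ v) {X : Type*} [Finite X] [Nonempty X] [MulAction G X]
    (hfree : ∀ v, ∀ g ∈ 𝒢.vertexSubgroup T φ v, ∀ x : X, g • x = x → g ∈ N) :
    IsVirtuallyFree (G ⧸ N) := by
  obtain ⟨v₀⟩ := hT.nonempty
  obtain ⟨x₀⟩ := ‹Nonempty X›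
  choose γ hγ using fun v =>
    MulAction.exists_equivariant_map (X := X) (𝒢.vertexSubgroup T φ v) N (hfree v)
  -- `A` is free on the set `G ⧸ N`. Only its freeness and the set-theoretic section `ι` of `Ψ` are
  -- needed.
  obtain ⟨A, _, _, Ψ, ι, hι⟩ : ∃ (A : Type _) (_ : Group A) (_ : IsFreeGroup A) (Ψ : A →* G ⧸ N)
      (ι : G ⧸ N → A), ∀ q, Ψ (ι q) = q :=
    ⟨FreeGroup (G ⧸ N), inferInstance, inferInstance, FreeGroup.lift id, FreeGroup.of,
      fun q => FreeGroup.lift_apply_of⟩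
  let t : E → G := 𝒢.letter φ
  -- `val` measures how far the stable letter is from matching the equivariant maps at the two ends
  -- of `e`; it is invariant under the edge group, so `inl (m e)` commutes with that group.
  let val : E → X → G ⧸ N := fun e x =>
    (γ (𝒢.src e) x)⁻¹ * (t e : G ⧸ N) * γ (𝒢.tgt e) ((t e)⁻¹ • x)
  let m : E → X → A := fun e x => ι (val e x)
  have hm : ∀ e x k, m e (𝒢.vertexMap φ (𝒢.src e) (𝒢.toSrc e k) • x) = m e x := by
    intro e x k
    have h1 := hγ (𝒢.src e) _ (𝒢.vertexMap_mem_vertexSubgroup φ _ (𝒢.toSrc e k)) x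
    have h2 := hγ (𝒢.tgt e) _ (𝒢.vertexMap_mem_vertexSubgroup φ _ (𝒢.toTgt e k)) ((t e)⁻¹ • x)
    have h3 : (t e)⁻¹ • 𝒢.vertexMap φ (𝒢.src e) (𝒢.toSrc e k) • x =
        𝒢.vertexMap φ (𝒢.tgt e) (𝒢.toTgt e k) • (t e)⁻¹ • x := by
      rw [← 𝒢.letter_conj φ e k]
      simp [mul_smul, t]
    simp only [m, val]
    rw [h3, h1, h2, ← 𝒢.letter_conj φ e k]
    simp [mul_assoc, t]
  -- Conjugating by `lam` cancels `m e` for `e ∈ T`, where `θ` must send the letter to `1`.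
  obtain ⟨lam, hlam⟩ := hT.exists_coboundary m
  obtain ⟨θ, hθv, hθe⟩ := 𝒢.exists_hom φ (B := (X → A) ⋊[mulAutArrow] G)
    (fun v => (MulAut.conj (SemidirectProduct.inl (lam v))).toMonoidHom.comp
      (SemidirectProduct.inr.comp (𝒢.vertexMap φ v)))
    (fun e => SemidirectProduct.inl (lam (𝒢.src e)) * SemidirectProduct.inl (m e) *
      SemidirectProduct.inr (t e) * (SemidirectProduct.inl (lam (𝒢.tgt e)))⁻¹)
    (fun e k => by
      have h1 : (SemidirectProduct.inl (m e) : (X → A) ⋊[mulAutArrow] G) *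
          SemidirectProduct.inr (𝒢.vertexMap φ (𝒢.src e) (𝒢.toSrc e k)) =
          SemidirectProduct.inr (𝒢.vertexMap φ (𝒢.src e) (𝒢.toSrc e k)) *
          SemidirectProduct.inl (m e) := by
        ext x
        · have := hm e ((𝒢.vertexMap φ (𝒢.src e) (𝒢.toSrc e k))⁻¹ • x) k
          rw [smul_inv_smul] at this
          simp [SemidirectProduct.mul_left_mulAutArrow_apply, ← this]
        · simp
      have h2 : (SemidirectProduct.inr (t e) : (X → A) ⋊[mulAutArrow] G) *
          SemidirectProduct.inr (𝒢.vertexMap φ (𝒢.tgt e) (𝒢.toTgt e k)) *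
          (SemidirectProduct.inr (t e))⁻¹ =
          SemidirectProduct.inr (𝒢.vertexMap φ (𝒢.src e) (𝒢.toSrc e k)) := by
        rw [← map_inv, ← map_mul, ← map_mul, 𝒢.letter_conj φ e k]
      have h3 := eq_mul_inv_of_mul_eq h1
      simp only [MonoidHom.comp_apply, MulEquiv.coe_toMonoidHom, MulAut.conj_apply]
      rw [← mul_inv_eq_iff_eq_mul.mpr h1, ← h2]
      group)
    (fun e he => by
      have h1 : t e = 1 := 𝒢.letter_eq_one φ he
      rw [hlam e he, h1]
      simp)
  have hright : ∀ g, (θ g).right = g := fun g => by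
    have : SemidirectProduct.rightHom.comp θ = MonoidHom.id G := by
      refine 𝒢.hom_ext φ (fun v x => ?_) fun e => ?_
      · simp [hθv]
      · simp [hθe, t]
    exact DFunLike.congr_fun this g
  -- On a tree edge `Ψ (m e x)` is `(γ (src e) x)⁻¹ * γ (tgt e) x`, so this discrepancy is the same
  -- at all vertices.
  have hκ : ∀ u v, (fun x => Ψ (lam u x) * (γ u x)⁻¹) = fun x => Ψ (lam v x) * (γ v x)⁻¹ :=
    hT.eq_of_edges (r := Eq) eq_equivalence _ fun e he => by
      funext x
      have h1 : t e = 1 := 𝒢.letter_eq_one φ he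
      simp [hlam e he, m, hι, val, h1, mul_assoc]
  let κ : X → G ⧸ N := fun x => Ψ (lam v₀ x) * (γ v₀ x)⁻¹
  have hlam' : ∀ v x, Ψ (lam v x) = κ x * γ v x := fun v x => by
    rw [← mul_inv_eq_iff_eq_mul]; exact congrFun (hκ v v₀) x
  -- Up to the change of gauge `κ`, `Ψ` sends the `A`-coordinates of `θ g` to the class of `g`. The
  -- identity is closed under products and inverses, so generators suffice.
  let K : Subgroup G :=
    { carrier := {g | ∀ x, Ψ ((θ g).left x) = κ x * (g : G ⧸ N) * (κ (g⁻¹ • x))⁻¹}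
      one_mem' := fun x => by simp
      mul_mem' := fun {a b} ha hb x => by
        have h1 : (θ (a * b)).left x = (θ a).left x * (θ b).left (a⁻¹ • x) := by
          simp [SemidirectProduct.mul_left_mulAutArrow_apply, hright]
        rw [h1, map_mul, ha x, hb]
        simp [mul_smul, mul_assoc]
      inv_mem' := fun {a} ha x => by
        have h1 : (θ a⁻¹).left x = ((θ a).left (a • x))⁻¹ := by
          simp [SemidirectProduct.inv_left_mulAutArrow_apply, hright]
        rw [h1, map_inv, ha]
        simp [mul_assoc] }
  have hvleft : ∀ v g x, (θ (𝒢.vertexMap φ v g)).left x =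
      lam v x * (lam v ((𝒢.vertexMap φ v g)⁻¹ • x))⁻¹ := fun v g x => by
    simp [hθv, SemidirectProduct.mul_left_mulAutArrow_apply,
      SemidirectProduct.inv_left_mulAutArrow_apply]
  have hK : K = ⊤ := by
    refine 𝒢.eq_top_of_generators φ (fun v g x => ?_) fun e x => ?_
    · have h1 := hγ v _ (𝒢.vertexMap_mem_vertexSubgroup φ v g) ((𝒢.vertexMap φ v g)⁻¹ • x)
      rw [smul_inv_smul] at h1
      rw [hvleft, map_mul, map_inv, hlam', hlam', h1]
      group
    · have h1 : (θ (𝒢.letter φ e)).left x =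
          lam (𝒢.src e) x * m e x * (lam (𝒢.tgt e) ((t e)⁻¹ • x))⁻¹ := by
        simp [hθe, SemidirectProduct.mul_left_mulAutArrow_apply,
          SemidirectProduct.inv_left_mulAutArrow_apply]
      rw [h1, map_mul, map_mul, map_inv, hlam', hlam']
      simp only [m, hι, val, t]
      group
  have hΨ : ∀ g x, Ψ ((θ g).left x) = κ x * (g : G ⧸ N) * (κ (g⁻¹ • x))⁻¹ := fun g =>
    (hK ▸ Subgroup.mem_top g : g ∈ K)
  let S := MulAction.stabilizer G x₀
  let h : S →* A :=
    { toFun := fun g => (θ g).left x₀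
      map_one' := by simp
      map_mul' := fun a b => by
        have : (a : G)⁻¹ • x₀ = x₀ := (inv_mem a.2 : (a : G)⁻¹ ∈ S)
        simp [SemidirectProduct.mul_left_mulAutArrow_apply, hright, this] }
  let p : S →* G ⧸ N := (QuotientGroup.mk' N).comp S.subtype
  have hker : h.ker = p.ker := by
    ext ⟨g, hg⟩
    have hg' : g⁻¹ • x₀ = x₀ := S.inv_mem hg
    have hp : p ⟨g, hg⟩ = (g : G ⧸ N) := rfl
    have hh : h ⟨g, hg⟩ = (θ g).left x₀ := rfl
    rw [MonoidHom.mem_ker, MonoidHom.mem_ker, hp, hh]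
    -- If the coordinate is trivial, the gauge identity at the fixed point `x₀` forces `g ∈ N`.
    -- Conversely `N` lies in the vertex group at `v₀`, where the coordinate is a quotient of values
    -- of `lam` at `x₀` and `g⁻¹ • x₀ = x₀`.
    constructor
    · intro h1
      have h2 := hΨ g x₀
      rw [h1, map_one, hg', eq_mul_inv_iff_mul_eq, one_mul] at h2
      exact mul_left_cancel (h2.symm.trans (mul_one _).symm)
    · intro h1
      obtain ⟨y, rfl⟩ := hN v₀ ((QuotientGroup.eq_one_iff _).mp h1)
      have h2 := hvleft v₀ y x₀
      exact h2.trans (mul_inv_eq_one.mpr (congrArg (lam v₀) hg'.symm))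
  refine ⟨p.range, ?_, MonoidHom.isFreeGroup_range_of_ker_eq p h hker⟩
  have hS : S.FiniteIndex := ⟨by
    rw [MulAction.index_stabilizer]
    exact (Set.ncard_pos (Set.toFinite _)).mpr ⟨_, MulAction.mem_orbit_self x₀⟩ |>.ne'⟩
  have hr : p.range = S.map (QuotientGroup.mk' N) := by
    rw [MonoidHom.range_comp, Subgroup.range_subtype]
  rw [hr]
  refine ⟨fun h0 => hS.index_ne_zero ?_⟩
  exact Nat.eq_zero_of_zero_dvd (h0 ▸ S.index_map_dvd (QuotientGroup.mk'_surjective N))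

theorem finiteIndex_comap_vertexMap {N : Subgroup G} {v : V}
    (hN : (N.subgroupOf (𝒢.vertexSubgroup T φ v)).FiniteIndex) :
    (N.comap (𝒢.vertexMap φ v)).FiniteIndex :=
  ⟨by rw [Subgroup.index_comap]; exact hN.index_ne_zero⟩

/-- If `N` is normal and of finite index in all the vertex groups of a finite graph of groups,
then the fundamental group acts on a finite set with all vertex stabilizers equal to `N`. -/
theorem exists_hom_perm [Finite V] (hT : 𝒢.IsSpanningTree T) (N : Subgroup G) [N.Normal]
    (hfin : ∀ v, (N.subgroupOf (𝒢.vertexSubgroup T φ v)).FiniteIndex) :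
    ∃ (n : ℕ) (ρ : G →* Equiv.Perm (Fin n)), n ≠ 0 ∧
      ∀ v, ∀ g ∈ 𝒢.vertexSubgroup T φ v, ∀ x, ρ g x = x ↔ g ∈ N := by
  have := Fintype.ofFinite V
  have hfin' := fun v => 𝒢.finiteIndex_comap_vertexMap φ (hfin v)
  -- A common multiple of the indices, so that every vertex group acts on the same set `Fin n`.
  let n := ∏ v, (N.comap (𝒢.vertexMap φ v)).index
  choose ρ hρ using fun v => (N.comap (𝒢.vertexMap φ v)).exists_hom_perm_fin (n := n)
    (Finset.dvd_prod_of_mem _ (Finset.mem_univ v))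
  -- Since `N` is normal, both actions of the edge group have the preimage of `N` as every
  -- stabilizer; the conjugating permutation serves as stable letter.
  choose t ht using fun e => MonoidHom.exists_perm_conj
    (S := N.comap ((𝒢.vertexMap φ (𝒢.src e)).comp (𝒢.toSrc e)))
    ((ρ (𝒢.tgt e)).comp (𝒢.toTgt e)) ((ρ (𝒢.src e)).comp (𝒢.toSrc e))
    (fun k x => by
      rw [MonoidHom.comp_apply, hρ, Subgroup.mem_comap, Subgroup.mem_comap, MonoidHom.comp_apply,
        ← 𝒢.letter_conj]
      rw [Subgroup.Normal.mem_comm_iff ‹_›, inv_mul_cancel_left])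
    (fun k x => hρ _ _ _)
  obtain ⟨s, hs⟩ := hT.exists_coboundary t
  obtain ⟨F, hF, -⟩ := 𝒢.exists_hom φ (fun v => (MulAut.conj (s v)).toMonoidHom.comp (ρ v))
    (fun e => s (𝒢.src e) * t e * (s (𝒢.tgt e))⁻¹)
    (fun e k => by
      have h := ht e k
      simp only [MonoidHom.comp_apply] at h
      simp only [MonoidHom.comp_apply, MulEquiv.coe_toMonoidHom, MulAut.conj_apply, ← h]
      group)
    (fun e he => by rw [hs e he, mul_inv_cancel])
  refine ⟨n, F, Finset.prod_ne_zero_iff.mpr fun v _ => (hfin' v).index_ne_zero, ?_⟩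
  rintro v _ ⟨g, rfl⟩ x
  have h1 : F (𝒢.vertexMap φ v g) x = s v (ρ v g ((s v)⁻¹ x)) := by
    rw [hF]; rfl
  change F (𝒢.vertexMap φ v g) x = x ↔ _
  rw [h1, ← Equiv.Perm.eq_inv_iff_eq, hρ]
  rfl

theorem isVirtuallyFree_quotient [Finite V] (hT : 𝒢.IsSpanningTree T) (N : Subgroup G) [N.Normal]
    (hN : ∀ v, N ≤ 𝒢.vertexSubgroup T φ v)
    (hfin : ∀ v, (N.subgroupOf (𝒢.vertexSubgroup T φ v)).FiniteIndex) :
    IsVirtuallyFree (G ⧸ N) := by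
  obtain ⟨n, ρ, hn, hρ⟩ := 𝒢.exists_hom_perm φ hT N hfin
  have : NeZero n := ⟨hn⟩
  let : MulAction G (Fin n) := MulAction.compHom _ ρ
  exact 𝒢.isVirtuallyFree_of_mulAction φ hT N hN (X := Fin n)
    (fun v g hg x h => (hρ v g hg x).mp h)

theorem fg_quotient [Finite V] [Finite E] (N : Subgroup G) [N.Normal]
    (hfin : ∀ v, (N.subgroupOf (𝒢.vertexSubgroup T φ v)).FiniteIndex) :
    Group.FG (G ⧸ N) := by
  let p := QuotientGroup.mk' N
  let S : Set (G ⧸ N) := (⋃ v, Set.range (p.comp (𝒢.vertexMap φ v))) ∪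
    Set.range fun e => p (𝒢.letter φ e)
  have hS : S.Finite := by
    refine (Set.finite_iUnion fun v => ?_).union (Set.finite_range _)
    have h1 : (p.comp (𝒢.vertexMap φ v)).ker.index ≠ 0 := by
      rw [← MonoidHom.comap_ker, QuotientGroup.ker_mk']
      exact (𝒢.finiteIndex_comap_vertexMap φ (hfin v)).index_ne_zero
    rw [Subgroup.index_ker] at h1
    exact Nat.finite_of_card_ne_zero h1
  refine Group.fg_iff.mpr ⟨S, ?_, hS⟩
  have h : (Subgroup.closure S).comap p = ⊤ :=
    𝒢.eq_top_of_generators φ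
      (fun v x => Subgroup.subset_closure (Or.inl (Set.mem_iUnion.mpr ⟨v, x, rfl⟩)))
      (fun e => Subgroup.subset_closure (Or.inr ⟨e, rfl⟩))
  rw [eq_top_iff]
  intro q _
  obtain ⟨g, rfl⟩ := QuotientGroup.mk'_surjective N q
  exact (h ▸ Subgroup.mem_top g : g ∈ (Subgroup.closure S).comap p)

end GraphOfGroups

/-! ### Finite stature and finite depth versus a normal subgroup. -/

section Stature

variable {G : Type*} [Group G] {Λ : Type*} {H : Λ → Subgroup G}

theorem mem_conj_smul_iff {H : Subgroup G} {g x : G} : x ∈ MulAut.conj g • H ↔ g⁻¹ * x * g ∈ H := by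
  rw [Subgroup.mem_pointwise_smul_iff_inv_smul_mem, ← map_inv]
  simp

theorem mem_conjInter {S : Set (Λ × G)} {x : G} :
    x ∈ conjInter H S ↔ ∀ p ∈ S, p.2⁻¹ * x * p.2 ∈ H p.1 := by
  simp only [conjInter, Subgroup.mem_iInf, mem_conj_smul_iff]

theorem conjInter_anti {S S' : Set (Λ × G)} (h : S ⊆ S') : conjInter H S' ≤ conjInter H S :=
  fun _ hx => mem_conjInter.mpr fun p hp => mem_conjInter.mp hx p (h hp)

theorem conjInter_le {S : Set (Λ × G)} {p : Λ × G} (hp : p ∈ S) :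
    conjInter H S ≤ MulAut.conj p.2 • H p.1 :=
  fun _ hx => mem_conj_smul_iff.mpr (mem_conjInter.mp hx p hp)

theorem conjInter_univ_normal : (conjInter H Set.univ).Normal := by
  refine ⟨fun n hn g => mem_conjInter.mpr fun p _ => ?_⟩
  have := mem_conjInter.mp hn (p.1, g⁻¹ * p.2) (Set.mem_univ _)
  simpa [mul_assoc] using this

theorem conjInter_univ_le (l : Λ) : conjInter H Set.univ ≤ H l := fun x hx => by
  simpa using mem_conjInter.mp hx (l, 1) (Set.mem_univ _)

theorem relIndex_conjInter_ne_zero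
    (hc : ∀ v w (g : G), (MulAut.conj g • H w).relIndex (H v) ≠ 0) {S : Set (Λ × G)} (hS : S.Finite)
    (v : Λ) : (conjInter H S).relIndex (H v) ≠ 0 := by
  have := hS.to_subtype
  rw [conjInter, iInf_subtype']
  exact Subgroup.relIndex_iInf_ne_zero fun p => hc _ _ _

/-- If a finite intersection of conjugates of pairwise commensurable subgroups lies in all
conjugates, it is a normal subgroup of finite index in every member of the family. -/
theorem exists_normal_of_minimal (hc : ∀ v w (g : G), (MulAut.conj g • H w).relIndex (H v) ≠ 0)
    {S : Set (Λ × G)} (hS : S.Finite) (hmin : ∀ p : Λ × G, conjInter H S ≤ MulAut.conj p.2 • H p.1) :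
    ∃ (N : Subgroup G) (_ : N.Normal), ∀ v, N ≤ H v ∧ (N.subgroupOf (H v)).FiniteIndex := by
  refine ⟨conjInter H Set.univ, conjInter_univ_normal, fun v => ⟨conjInter_univ_le v, ⟨?_⟩⟩⟩
  have h : conjInter H Set.univ = conjInter H S :=
    le_antisymm (conjInter_anti (Set.subset_univ S)) fun x hx =>
      mem_conjInter.mpr fun p _ => mem_conj_smul_iff.mp (hmin p hx)
  rw [h]
  exact relIndex_conjInter_ne_zero hc hS v

/-- If no finite intersection lies in all conjugates, each can be shrunk by one more conjugate,
giving descending chains of every length. -/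
theorem exists_normal_of_hasFiniteCommensurableDepth [Nonempty Λ]
    (hc : ∀ v w (g : G), (MulAut.conj g • H w).relIndex (H v) ≠ 0)
    (h : HasFiniteCommensurableDepth H) :
    ∃ (N : Subgroup G) (_ : N.Normal), ∀ v, N ≤ H v ∧ (N.subgroupOf (H v)).FiniteIndex := by
  obtain ⟨v₀⟩ := ‹Nonempty Λ›
  by_contra hno
  let 𝓛 := {L : Subgroup G // ∃ S : Set (Λ × G), S.Finite ∧ S.Nonempty ∧ L = conjInter H S}
  have : Nonempty 𝓛 := ⟨⟨_, {(v₀, 1)}, Set.finite_singleton _, Set.singleton_nonempty _, rfl⟩⟩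
  have : NoMinOrder 𝓛 := ⟨by
    rintro ⟨_, S, hS, hS', rfl⟩
    have hmin : ¬ ∀ p : Λ × G, conjInter H S ≤ MulAut.conj p.2 • H p.1 :=
      fun hmin => hno (exists_normal_of_minimal hc hS hmin)
    push Not at hmin
    obtain ⟨p, hp⟩ := hmin
    refine ⟨⟨conjInter H (insert p S), insert p S, hS.insert p, Set.insert_nonempty p S, rfl⟩, ?_⟩
    refine lt_of_le_not_ge (conjInter_anti (Set.subset_insert p S)) fun hle => ?_
    exact hp (le_trans hle (conjInter_le (Set.mem_insert p S)))⟩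
  obtain ⟨f, hf⟩ := Nat.exists_strictAnti 𝓛
  have hle : ∀ d : ℕ, (d : ℕ∞) ≤ commensurableDepth H := fun d =>
    le_sSup ⟨d, fun i => (f (Fin.rev i) : 𝓛).1, rfl,
      fun i j hij => hf (Fin.rev_lt_rev.mpr hij), fun i => (f (Fin.rev i)).2⟩
  exact h.ne (ENat.eq_top_iff_forall_ge.mpr hle)

theorem relIndex_of_mem_subgroupConjClass {K L M : Subgroup G} (hM : M ∈ subgroupConjClass K L) :
    M.relIndex K = L.relIndex K := by
  obtain ⟨k, hk, rfl⟩ := hM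
  conv_lhs => rw [← Subgroup.conj_smul_eq_self_of_mem hk]
  exact Subgroup.relIndex_pointwise_smul _ _ _

theorem exists_normal_of_hasFiniteStature
    (hc : ∀ v w (g : G), (MulAut.conj g • H w).relIndex (H v) ≠ 0)
    (h : HasFiniteStature H) :
    ∃ (N : Subgroup G) (_ : N.Normal), ∀ v, N ≤ H v ∧ (N.subgroupOf (H v)).FiniteIndex := by
  by_cases hfin : ∀ v, Finite (H v)
  · exact ⟨⊥, inferInstance, fun v => ⟨bot_le, have := hfin v; inferInstance⟩⟩
  push Not at hfin
  obtain ⟨μ, hμ⟩ := hfin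
  let idx : Set (Λ × G) → ℕ := fun S => (H μ ⊓ conjInter H S).relIndex (H μ)
  have hidx : ∀ S : Set (Λ × G), S.Finite → idx S ≠ 0 := fun S hS => by
    simp only [idx]
    rw [inf_comm, Subgroup.inf_relIndex_right]
    exact relIndex_conjInter_ne_zero hc hS μ
  let I : Set ℕ := {i | ∃ S : Set (Λ × G), S.Finite ∧ S.Nonempty ∧ i = idx S}
  have hI : I.Finite := by
    -- The index is constant on a conjugacy class, so `sInf` reads it off from the class.
    refine ((h μ).image fun c => sInf ((fun M => M.relIndex (H μ)) '' c)).subset ?_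
    rintro _ ⟨S, hS, hS', rfl⟩
    refine ⟨_, ⟨S, hS', ?_, rfl⟩, ?_⟩
    -- A finite subgroup of finite index would make `H μ` finite.
    · by_contra hf
      rw [not_infinite_iff_finite] at hf
      have h1 := Subgroup.relIndex_mul_relIndex ⊥ (H μ ⊓ conjInter H S) (H μ) bot_le inf_le_left
      rw [Subgroup.relIndex_bot_left, Subgroup.relIndex_bot_left] at h1
      have h2 : Nat.card (H μ) ≠ 0 := h1 ▸ mul_ne_zero Nat.card_pos.ne' (hidx S hS)
      exact hμ.not_finite (Nat.finite_of_card_ne_zero h2)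
    · have : (fun M => M.relIndex (H μ)) '' subgroupConjClass (H μ) (H μ ⊓ conjInter H S) =
          {idx S} := by
        refine Set.Subset.antisymm ?_ ?_
        · rintro _ ⟨M, hM, rfl⟩
          exact relIndex_of_mem_subgroupConjClass hM
        · rintro _ rfl
          exact ⟨_, ⟨1, one_mem _, by simp⟩, rfl⟩
      simp only [this, csInf_singleton]
  obtain ⟨_, ⟨S, hS, hS', rfl⟩, hmax⟩ := Set.exists_max_image I id hI
    ⟨_, {(μ, 1)}, Set.finite_singleton _, Set.singleton_nonempty _, rfl⟩
  -- Maximality concerns `H μ ⊓ conjInter H S`; adding `(μ, 1)` places the intersection inside it.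
  refine exists_normal_of_minimal hc (hS.insert (μ, 1)) fun p => ?_
  have hle : H μ ⊓ conjInter H (insert p S) ≤ H μ ⊓ conjInter H S :=
    inf_le_inf_left _ (conjInter_anti (Set.subset_insert p S))
  have h1 := Subgroup.relIndex_mul_relIndex _ _ _ hle inf_le_left
  have h2 : idx (insert p S) ≤ idx S := hmax _ ⟨_, hS.insert p, Set.insert_nonempty p S, rfl⟩
  have h3 := hidx _ (hS.insert p)
  have h4 := hidx _ hS
  simp only [idx] at h2 h3 h4
  have h5 : (H μ ⊓ conjInter H (insert p S)).relIndex (H μ ⊓ conjInter H S) = 1 := by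
    rw [← h1] at h2 h3
    have h6 : (H μ ⊓ conjInter H (insert p S)).relIndex (H μ ⊓ conjInter H S) ≠ 0 :=
      left_ne_zero_of_mul h3
    have := Nat.le_of_mul_le_mul_right (h2.trans_eq (one_mul _).symm) (Nat.pos_of_ne_zero h4)
    omega
  rw [Subgroup.relIndex_eq_one] at h5
  calc conjInter H (insert (μ, 1) S) ≤ H μ ⊓ conjInter H S :=
        le_inf (by simpa using conjInter_le (H := H) (Set.mem_insert (μ, (1 : G)) S))
          (conjInter_anti (Set.subset_insert _ S))
    _ ≤ H μ ⊓ conjInter H (insert p S) := h5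
    _ ≤ MulAut.conj p.2 • H p.1 := inf_le_right.trans (conjInter_le (Set.mem_insert p S))

theorem le_conj_smul_of_normal {N K : Subgroup G} [N.Normal] (h : N ≤ K) (g : G) :
    N ≤ MulAut.conj g • K := fun n hn =>
  mem_conj_smul_iff.mpr (h (by simpa using Subgroup.Normal.conj_mem ‹_› n hn g⁻¹))

theorem le_conjInter_of_normal {N : Subgroup G} [N.Normal] (h : ∀ v, N ≤ H v)
    (S : Set (Λ × G)) : N ≤ conjInter H S :=
  le_iInf₂ fun p _ => le_conj_smul_of_normal (h p.1) p.2

/-- Along a strict chain the index of `N` strictly increases, and it is bounded by the largest index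
of `N` in a member of the family. -/
theorem hasFiniteCommensurableDepth_of_normal [Finite Λ] {N : Subgroup G} [N.Normal]
    (hN : ∀ v, N ≤ H v ∧ (N.subgroupOf (H v)).FiniteIndex) : HasFiniteCommensurableDepth H := by
  obtain ⟨B, hB⟩ : ∃ B, ∀ v, N.relIndex (H v) ≤ B := by
    obtain ⟨B, hB⟩ := (Set.finite_range fun v => N.relIndex (H v)).bddAbove
    exact ⟨B, fun v => hB ⟨v, rfl⟩⟩
  have hconj : ∀ v (g : G), N.relIndex (MulAut.conj g • H v) = N.relIndex (H v) := fun v g => by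
    conv_lhs => rw [← Subgroup.Normal.conj_smul_eq_self g N]
    exact Subgroup.relIndex_pointwise_smul _ _ _
  refine lt_of_le_of_lt (sSup_le (a := ((B + 1 : ℕ) : ℕ∞)) ?_) (ENat.natCast_lt_top _)
  rintro _ ⟨d, L, rfl, hL, hLS⟩
  have hNL : ∀ i, N ≤ L i := fun i => by
    obtain ⟨S, -, -, hS⟩ := hLS i
    exact hS ▸ le_conjInter_of_normal (fun v => (hN v).1) S
  have hLi : ∀ i, N.relIndex (L i) ≠ 0 ∧ N.relIndex (L i) ≤ B := fun i => by
    obtain ⟨S, -, ⟨p, hp⟩, hS⟩ := hLS i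
    have h1 : L i ≤ MulAut.conj p.2 • H p.1 := hS ▸ conjInter_le hp
    have h2 : N.relIndex (MulAut.conj p.2 • H p.1) ≠ 0 := by
      rw [hconj]; exact (hN p.1).2.index_ne_zero
    exact ⟨fun h0 => h2 (Subgroup.relIndex_eq_zero_of_le_right h1 h0),
      (Subgroup.relIndex_le_of_le_right h1 h2).trans ((hconj _ _).trans_le (hB _))⟩
  have hinj : StrictMono fun i => N.relIndex (L i) := fun i j hij => by
    have h1 := Subgroup.relIndex_mul_relIndex _ _ _ (hNL i) (hL hij).le
    refine lt_of_le_of_ne (Subgroup.relIndex_le_of_le_right (hL hij).le (hLi j).1) fun h2 => ?_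
    simp only at h2
    rw [← h2] at h1
    have h3 := Nat.eq_of_mul_eq_mul_left (Nat.pos_of_ne_zero (hLi i).1)
      (h1.trans (mul_one _).symm)
    exact (hL hij).not_ge (Subgroup.relIndex_eq_one.mp h3)
  have := Fintype.card_le_of_injective
    (fun i => (⟨N.relIndex (L i), Nat.lt_succ_of_le (hLi i).2⟩ : Fin (B + 1)))
    fun i j hij => hinj.injective (Fin.mk.inj hij)
  simpa using (Nat.cast_le (α := ℕ∞)).mpr this

/-- Such subgroups correspond to subsets of the finite image of `K` in `G ⧸ N`. -/
theorem Subgroup.finite_setOf_between {N K : Subgroup G} [N.Normal]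
    (h : N.relIndex K ≠ 0) : {L : Subgroup G | N ≤ L ∧ L ≤ K}.Finite := by
  have hK : ((K.map (QuotientGroup.mk' N) : Subgroup (G ⧸ N)) : Set (G ⧸ N)).Finite := by
    rw [← QuotientGroup.ker_mk' N, Subgroup.relIndex_ker] at h
    exact Nat.finite_of_card_ne_zero h
  refine Set.Finite.of_finite_image (f := fun L => (L.map (QuotientGroup.mk' N) : Set (G ⧸ N)))
    (hK.finite_subsets.subset ?_) ?_
  · rintro _ ⟨L, hL, rfl⟩
    exact Subgroup.map_mono hL.2
  · intro L hL L' hL' heq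
    have h1 := congrArg (Subgroup.comap (QuotientGroup.mk' N)) (SetLike.coe_injective heq)
    rwa [Subgroup.comap_map_eq_self (by simpa using hL.1),
      Subgroup.comap_map_eq_self (by simpa using hL'.1)] at h1

theorem hasFiniteStature_of_normal {N : Subgroup G} [N.Normal]
    (hN : ∀ v, N ≤ H v ∧ (N.subgroupOf (H v)).FiniteIndex) : HasFiniteStature H := by
  intro μ
  refine ((Subgroup.finite_setOf_between (hN μ).2.index_ne_zero).image
    (subgroupConjClass (H μ))).subset ?_
  rintro _ ⟨S, -, -, rfl⟩
  exact ⟨_, ⟨le_inf (hN μ).1 (le_conjInter_of_normal (fun v => (hN v).1) S), inf_le_left⟩, rfl⟩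

end Stature

/-! ### Commensurability of the vertex groups, and the equivalence. -/

theorem toConjAct_smul_eq {G : Type*} [Group G] (g : G) (K : Subgroup G) :
    ConjAct.toConjAct g • K = MulAut.conj g • K := by
  ext x
  rw [mem_conj_smul_iff, Subgroup.mem_pointwise_smul_iff_inv_smul_mem, ConjAct.smul_def]
  simp

namespace GraphOfGroups

variable {V E : Type*} (𝒢 : GraphOfGroups V E) {T : Set E} {G : Type*} [Group G]
  (φ : 𝒢.FundamentalGroup T ≃* G)

/-- Both groups contain the image of the edge group with finite index. -/
theorem commensurable_edge
    (hfin : ∀ e, (𝒢.toSrc e).range.FiniteIndex ∧ (𝒢.toTgt e).range.FiniteIndex) (e : E) :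
    Subgroup.Commensurable
      (ConjAct.toConjAct (𝒢.letter φ e) • 𝒢.vertexSubgroup T φ (𝒢.tgt e))
      (𝒢.vertexSubgroup T φ (𝒢.src e)) := by
  rw [toConjAct_smul_eq]
  have key : ∀ (v : V) (K : Subgroup (𝒢.vertexGroup v)), K.FiniteIndex →
      (K.map (𝒢.vertexMap φ v)).relIndex (𝒢.vertexSubgroup T φ v) ≠ 0 := fun v K hK => by
    rw [← 𝒢.range_vertexMap, MonoidHom.range_eq_map, Subgroup.relIndex_map_map, top_sup_eq,
      Subgroup.relIndex_top_right]
    exact (Subgroup.finiteIndex_of_le (H := K) le_sup_left).index_ne_zero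
  have hI : (𝒢.toSrc e).range.map (𝒢.vertexMap φ (𝒢.src e)) =
      MulAut.conj (𝒢.letter φ e) • (𝒢.toTgt e).range.map (𝒢.vertexMap φ (𝒢.tgt e)) := by
    ext x
    rw [mem_conj_smul_iff]
    constructor
    · rintro ⟨_, ⟨k, rfl⟩, rfl⟩
      refine ⟨_, ⟨k, rfl⟩, ?_⟩
      rw [← 𝒢.letter_conj φ e k]
      group
    · rintro ⟨_, ⟨k, rfl⟩, hk⟩
      refine ⟨_, ⟨k, rfl⟩, ?_⟩
      rw [← 𝒢.letter_conj φ e k, hk]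
      group
  have h1 := key _ _ (hfin e).1
  have h2 := key _ _ (hfin e).2
  constructor
  · refine ne_zero_of_dvd_ne_zero h1 (Subgroup.relIndex_dvd_of_le_left _ ?_)
    rw [hI, Subgroup.pointwise_smul_le_pointwise_smul_iff]
    exact Subgroup.map_le_range _ _
  · rw [← Subgroup.relIndex_pointwise_smul (MulAut.conj (𝒢.letter φ e)), ← hI] at h2
    exact ne_zero_of_dvd_ne_zero h2 (Subgroup.relIndex_dvd_of_le_left _
      (Subgroup.map_le_range _ _))

/-- Tree edges make the vertex groups commensurable with one another; the commensurator of any one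
of them then contains all vertex groups and stable letters, hence is `G`. -/
theorem relIndex_conj_vertexSubgroup_ne_zero (hT : 𝒢.IsSpanningTree T)
    (hfin : ∀ e, (𝒢.toSrc e).range.FiniteIndex ∧ (𝒢.toTgt e).range.FiniteIndex) (v w : V) (g : G) :
    (MulAut.conj g • 𝒢.vertexSubgroup T φ w).relIndex (𝒢.vertexSubgroup T φ v) ≠ 0 := by
  have hvw : ∀ v w, Subgroup.Commensurable (𝒢.vertexSubgroup T φ v) (𝒢.vertexSubgroup T φ w) :=
    hT.eq_of_edges _ Subgroup.Commensurable.equivalence _ fun e he => by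
      have := 𝒢.commensurable_edge φ hfin e
      rw [𝒢.letter_eq_one φ he, map_one, one_smul] at this
      exact this.symm
  have htop : Subgroup.Commensurable.commensurator (𝒢.vertexSubgroup T φ w) = ⊤ := by
    refine 𝒢.eq_top_of_generators φ (fun u x => ?_) fun e => ?_
    · rw [Subgroup.Commensurable.eq (hvw w u), Subgroup.Commensurable.commensurator_mem_iff,
        toConjAct_smul_eq, Subgroup.conj_smul_eq_self_of_mem (𝒢.vertexMap_mem_vertexSubgroup φ u x)]
    · exact ((hvw w (𝒢.tgt e)).conj _).trans ((𝒢.commensurable_edge φ hfin e).trans (hvw _ _))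
  have hg : g ∈ Subgroup.Commensurable.commensurator (𝒢.vertexSubgroup T φ w) :=
    htop ▸ Subgroup.mem_top g
  rw [Subgroup.Commensurable.commensurator_mem_iff, toConjAct_smul_eq] at hg
  exact (hg.trans (hvw w v)).1

end GraphOfGroups

theorem mainTheorem5 {V E : Type*} [Finite V] [Finite E] (𝒢 : GraphOfGroups V E)
    (hfin : ∀ e, (𝒢.toSrc e).range.FiniteIndex ∧ (𝒢.toTgt e).range.FiniteIndex)
    (T : Set E) (hT : 𝒢.IsSpanningTree T)
    {G : Type*} [Group G] (φ : 𝒢.FundamentalGroup T ≃* G) :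
    List.TFAE [
      HasFiniteStature (𝒢.vertexSubgroup T φ),
      HasFiniteCommensurableDepth (𝒢.vertexSubgroup T φ),
      ∃ (N : Subgroup G) (_ : N.Normal),
        (∀ v, N ≤ 𝒢.vertexSubgroup T φ v ∧
          (N.subgroupOf (𝒢.vertexSubgroup T φ v)).FiniteIndex) ∧
        Group.FG (G ⧸ N) ∧ IsVirtuallyFree (G ⧸ N)] := by
  have hc := 𝒢.relIndex_conj_vertexSubgroup_ne_zero φ hT hfin
  have := hT.nonempty
  have hquot : (∃ (N : Subgroup G) (_ : N.Normal), ∀ v, N ≤ 𝒢.vertexSubgroup T φ v ∧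
      (N.subgroupOf (𝒢.vertexSubgroup T φ v)).FiniteIndex) →
      ∃ (N : Subgroup G) (_ : N.Normal),
        (∀ v, N ≤ 𝒢.vertexSubgroup T φ v ∧
          (N.subgroupOf (𝒢.vertexSubgroup T φ v)).FiniteIndex) ∧
        Group.FG (G ⧸ N) ∧ IsVirtuallyFree (G ⧸ N) := fun ⟨N, hN, h⟩ =>
    ⟨N, hN, h, 𝒢.fg_quotient φ N fun v => (h v).2,
      𝒢.isVirtuallyFree_quotient φ hT N (fun v => (h v).1) fun v => (h v).2⟩
  tfae_have 1 → 3 := fun h => hquot (exists_normal_of_hasFiniteStature hc h)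
  tfae_have 2 → 3 := fun h => hquot (exists_normal_of_hasFiniteCommensurableDepth hc h)
  tfae_have 3 → 1 := fun ⟨_, _, h, _⟩ => hasFiniteStature_of_normal h
  tfae_have 3 → 2 := fun ⟨_, _, h, _⟩ => hasFiniteCommensurableDepth_of_normal h
  tfae_finish
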